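/- Let $N \ge 0$ be an integer and let $\Omega_N \subset \mathbf{R}^N$ be the set of all $(a_1,\dots,a_N)$ such that every complex root of the monic polynomial $P(x) = x^N + a_1 x^{N-1} + \dots + a_N$ has absolute value at most $1$. Let $dV = da_1 \cdots da_N$ denote Lebesgue measure on $\mathbf{R}^N$ (for $N = 0$, the unit mass at the point). Then for all complex numbers $\alpha, \beta$ with $\mathrm{Re}(\alpha) > 0$ and $\mathrm{Re}(\beta) > 0$, the integral $$S_N(\alpha,\beta) = \int_{\Omega_N} P(1)^{\alpha-1}\,|P(-1)|^{\beta-1}\,dV$$ converges absolutely, and $$\begin{aligned} S_N(\alpha,\beta) &= \prod_{\substack{k \ge 1 \\ 2k \le N}} 2^{\alpha+\beta+2k-2}\,\frac{\Gamma(\alpha+\beta+k-1)\,\Gamma(k)}{\Gamma(\alpha+\beta+2k-1)} \prod_{\substack{k \ge 0 \\ 2k+1 \le N}} 2^{\alpha+\beta+2k-1}\,\frac{\Gamma(\alpha+k)\,\Gamma(\beta+k)}{\Gamma(\alpha+\beta+2k)} \\ &= \prod_{k=1}^{N} \frac{2^{\alpha+\beta+k-2}}{\Gamma(\alpha+\beta+k-1)}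 \prod_{\substack{k \ge 1 \\ 2k \le N}} \Gamma(\alpha+\beta+k-1)\,\Gamma(k) \prod_{\substack{k \ge 1 \\ 2k-1 \le N}} \Gamma(\alpha+k-1)\,\Gamma(\beta+k-1). \end{aligned}$$ -/

import Mathlib

open MeasureTheory

noncomputable section

/-- The monic real polynomial `X ^ N + a₁ X ^ (N - 1) + ⋯ + a_N` with coefficient vector
`(a₁, …, a_N)`; since `Fin N` counts from `0`, the coefficient `a_j` is `a (j - 1)`. -/
def monicPoly {N : ℕ} (a : Fin N → ℝ) : Polynomial ℝ :=
  Polynomial.X ^ N +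
    ∑ i : Fin N, Polynomial.C (a i) * Polynomial.X ^ (N - ((i : ℕ) + 1))

/-- The region `Ω_N ⊆ ℝ ^ N` of coefficient vectors of monic real polynomials of degree `N`
all of whose complex roots have absolute value at most one. -/
def Omega (N : ℕ) : Set (Fin N → ℝ) :=
  {a | ∀ z : ℂ, Polynomial.aeval z (monicPoly a) = 0 → ‖z‖ ≤ 1}

/-- The integrand `P(1) ^ (α - 1) |P(-1)| ^ (β - 1)`. The value `P(1)` is a nonnegative real
number for every `P` in `Ω_N`, so that both powers have nonnegative real bases there. -/
def selbergIntegrand (N : ℕ) (α β : ℂ) (a : Fin N → ℝ) : ℂ :=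
  (((monicPoly a).eval 1 : ℝ) : ℂ) ^ (α - 1) *
    ((|(monicPoly a).eval (-1)| : ℝ) : ℂ) ^ (β - 1)

/-- The integral `S_N(α, β)` over `Ω_N` with respect to Lebesgue measure on `ℝ ^ N`. -/
def selbergIntegral (N : ℕ) (α β : ℂ) : ℂ :=
  ∫ a in Omega N, selbergIntegrand N α β a ∂(volume : Measure (Fin N → ℝ))

end

/-! Induction on the degree through the Schur–Cohn (Levinson) recursion. Write `P = X * Q + r *
Q.reverse`, where `r` is the constant term of `P`. For `|r| < 1`, `P` has its roots in the closed
unit disc iff `Q` does (`levinson_mem_Omega`), so up to a null set `Ω_{N+1}` is `(-1, 1) × Ω_N`. For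
fixed `r` the map is linear in the coefficients of `Q`, with determinant a product of powers of `1 +
r` and `1 - r` (`det_reflectAdd`). Since `P(1) = (1 + r) Q(1)` and `|P(-1)| = (1 ∓ r) |Q(-1)|`, the
integral splits as a beta integral in `r` times the integral for `N` (`selberg_succ`). The parity of
`N` decides which factor `P(-1)` contributes, hence the two kinds of Gamma quotient. -/

/-! ### Monic polynomials with all roots in the closed unit disc. -/

theorem aeval_monicPoly {K : Type*} [Field K] [Algebra ℝ K] {N : ℕ} (a : Fin N → ℝ) (z : K) :
    Polynomial.aeval z (monicPoly a) =
      z ^ N + ∑ i : Fin N, algebraMap ℝ K (a i) * z ^ (N - ((i : ℕ) + 1)) := by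
  simp [monicPoly]

theorem monicPoly_degree_sum_lt {N : ℕ} (a : Fin N → ℝ) :
    (∑ i : Fin N, Polynomial.C (a i) * Polynomial.X ^ (N - ((i : ℕ) + 1))).degree <
      (N : WithBot ℕ) := by
  rw [← Polynomial.mem_degreeLT]
  refine Submodule.sum_mem _ fun i _ => Polynomial.mem_degreeLT.2 ?_
  refine (Polynomial.degree_C_mul_X_pow_le _ _).trans_lt ?_
  have := i.2
  exact_mod_cast (by omega : N - ((i : ℕ) + 1) < N)

theorem monicPoly_monic {N : ℕ} (a : Fin N → ℝ) : (monicPoly a).Monic :=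
  Polynomial.monic_X_pow_add (monicPoly_degree_sum_lt a)

theorem monicPoly_natDegree {N : ℕ} (a : Fin N → ℝ) : (monicPoly a).natDegree = N := by
  apply Polynomial.natDegree_eq_of_degree_eq_some
  rw [monicPoly, Polynomial.degree_add_eq_left_of_degree_lt] <;>
    rw [Polynomial.degree_X_pow]
  exact monicPoly_degree_sum_lt a

theorem exists_multiset_roots {N : ℕ} (a : Fin N → ℝ) :
    ∃ s : Multiset ℂ, s.card = N ∧
      (∀ z : ℂ, Polynomial.aeval z (monicPoly a) = (s.map fun w => z - w).prod) ∧
      ∀ w ∈ s, Polynomial.aeval w (monicPoly a) = 0 := by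
  set p : Polynomial ℂ := (monicPoly a).map (algebraMap ℝ ℂ) with hp
  have hm : p.Monic := (monicPoly_monic a).map _
  have hs : p.Splits := IsAlgClosed.splits p
  have hd : p.natDegree = N := by
    rw [hp, Polynomial.natDegree_map, monicPoly_natDegree]
  have he : ∀ z : ℂ, Polynomial.aeval z (monicPoly a) = p.eval z := fun z => by
    rw [hp, Polynomial.eval_map_algebraMap]
  refine ⟨p.roots, ?_, ?_, ?_⟩
  · rw [← hs.natDegree_eq_card_roots, hd]
  · intro z
    rw [he, hs.eval_eq_prod_roots_of_monic hm]
  · intro w hw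
    rw [he]
    exact (Polynomial.mem_roots'.1 hw).2

theorem sub_one_pow_le_norm_aeval {N : ℕ} {a : Fin N → ℝ} (ha : a ∈ Omega N) {z : ℂ}
    (hz : 1 ≤ ‖z‖) : (‖z‖ - 1) ^ N ≤ ‖Polynomial.aeval z (monicPoly a)‖ := by
  obtain ⟨s, hc, he, hr⟩ := exists_multiset_roots a
  rw [he, ← hc]
  have hs : ∀ w ∈ s, ‖w‖ ≤ 1 := fun w hw => ha w (hr w hw)
  clear hc he hr
  induction s using Multiset.induction_on with
  | empty => simp
  | cons w s ih =>
    have h1 : ‖w‖ ≤ 1 := hs w (by simp)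
    have h2 := norm_sub_norm_le z w
    rw [Multiset.map_cons, Multiset.prod_cons, norm_mul, Multiset.card_cons, pow_succ']
    exact mul_le_mul (by linarith) (ih fun w hw => hs w (by simp [hw]))
      (pow_nonneg (by linarith) _) (norm_nonneg _)

theorem norm_aeval_conj (p : Polynomial ℝ) (z : ℂ) :
    ‖Polynomial.aeval (starRingEnd ℂ z) p‖ = ‖Polynomial.aeval z p‖ := by
  rw [Polynomial.aeval_conj, RCLike.norm_conj]

/-- The difference of the squared norms is `(‖z‖² - 1)(1 - ‖w‖²)`. -/
theorem norm_one_sub_conj_mul_le {w z : ℂ} (hw : ‖w‖ ≤ 1) (hz : 1 ≤ ‖z‖) :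
    ‖1 - starRingEnd ℂ z * w‖ ≤ ‖z - w‖ := by
  have h1 : Complex.normSq w ≤ 1 := by
    rw [Complex.normSq_eq_norm_sq]; exact pow_le_one₀ (norm_nonneg _) hw
  have h2 : 1 ≤ Complex.normSq z := by
    rw [Complex.normSq_eq_norm_sq]; exact one_le_pow₀ hz
  rw [Complex.norm_def, Complex.norm_def]
  apply Real.sqrt_le_sqrt
  simp only [Complex.normSq_apply, Complex.sub_re, Complex.sub_im, Complex.mul_re,
    Complex.mul_im, Complex.conj_re, Complex.conj_im, Complex.one_re, Complex.one_im] at *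
  nlinarith [mul_nonneg (sub_nonneg.2 h1) (sub_nonneg.2 h2)]

/-- The reversed polynomial is dominated by the polynomial outside the disc, root by root. Real
coefficients allow `z⁻¹` to be replaced by its conjugate. -/
theorem norm_pow_mul_aeval_inv_le {N : ℕ} {a : Fin N → ℝ} (ha : a ∈ Omega N) {z : ℂ}
    (hz : 1 ≤ ‖z‖) :
    ‖z ^ N * Polynomial.aeval z⁻¹ (monicPoly a)‖ ≤ ‖Polynomial.aeval z (monicPoly a)‖ := by
  have hz0 : z ≠ 0 := by rintro rfl; simp at hz; linarith
  rw [norm_mul, ← norm_aeval_conj _ z⁻¹, norm_pow, ← RCLike.norm_conj z, map_inv₀,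
    ← norm_pow, ← norm_mul]
  have hc0 : starRingEnd ℂ z ≠ 0 := by simpa using hz0
  obtain ⟨s, hc, he, hr⟩ := exists_multiset_roots a
  rw [he, he, ← hc]
  have hs : ∀ w ∈ s, ‖w‖ ≤ 1 := fun w hw => ha w (hr w hw)
  clear hc he hr
  induction s using Multiset.induction_on with
  | empty => simp
  | cons w s ih =>
    rw [Multiset.map_cons, Multiset.prod_cons, Multiset.map_cons, Multiset.prod_cons,
      Multiset.card_cons, pow_succ', mul_mul_mul_comm, norm_mul,
      norm_mul (z - w)]
    refine mul_le_mul ?_ (ih fun w hw => hs w (by simp [hw])) (norm_nonneg _) (norm_nonneg _)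
    rw [mul_sub, mul_inv_cancel₀ hc0]
    exact norm_one_sub_conj_mul_le (hs w (by simp)) hz

theorem isClosed_Omega (N : ℕ) : IsClosed (Omega N) := by
  -- Nonvanishing outside the disc is an open-looking condition; the uniform lower bound makes it
  -- closed.
  have h : Omega N = ⋂ z : ℂ, ⋂ _ : 1 < ‖z‖,
      {a | (‖z‖ - 1) ^ N ≤ ‖Polynomial.aeval z (monicPoly a)‖} := by
    ext a
    simp only [Set.mem_iInter, Set.mem_ofPred_eq]
    refine ⟨fun ha z hz => sub_one_pow_le_norm_aeval ha hz.le, fun ha z hz => ?_⟩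
    by_contra! hlt
    have := ha z hlt
    rw [hz, norm_zero] at this
    exact absurd this (not_le.2 (pow_pos (by linarith) _))
  rw [h]
  refine isClosed_iInter fun z => isClosed_iInter fun _ => isClosed_le continuous_const ?_
  simp only [aeval_monicPoly]
  refine Continuous.norm (continuous_const.add (continuous_finsetSum _ fun i _ => ?_))
  exact ((continuous_algebraMap ℝ ℂ).comp (continuous_apply i)).mul continuous_const

/-- The constant term is, up to sign, the product of the roots. This confines the parameter `r` to
`[-1, 1]`. -/
theorem abs_last_le_one {N : ℕ} {a : Fin (N + 1) → ℝ} (ha : a ∈ Omega (N + 1)) :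
    |a (Fin.last N)| ≤ 1 := by
  obtain ⟨s, -, he, hr⟩ := exists_multiset_roots a
  have hs : ∀ w ∈ s, ‖w‖ ≤ 1 := fun w hw => ha w (hr w hw)
  have h0 : (a (Fin.last N) : ℂ) = (s.map fun w => 0 - w).prod := by
    rw [← he, aeval_monicPoly, Fin.sum_univ_castSucc]
    have : ∀ i : Fin N, N - (i : ℕ) ≠ 0 := fun i => by omega
    simp [this]
  rw [← Real.norm_eq_abs, ← Complex.norm_real, h0]
  clear h0 he hr
  induction s using Multiset.induction_on with
  | empty => simp
  | cons w s ih =>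
    rw [Multiset.map_cons, Multiset.prod_cons, norm_mul]
    exact mul_le_one₀ (by simpa using hs w (by simp)) (norm_nonneg _)
      (ih fun w hw => hs w (by simp [hw]))

/-! ### The Levinson recursion and its effect on roots and integrand. -/

/-- The linear map on coefficient vectors which sends `Q` to the inner coefficients of
`X * Q + r * Q.reverse`. -/
def reflectAdd (N : ℕ) (r : ℝ) : (Fin N → ℝ) →ₗ[ℝ] (Fin N → ℝ) :=
  LinearMap.id + r • LinearMap.funLeft ℝ ℝ Fin.rev

theorem reflectAdd_apply {N : ℕ} (r : ℝ) (a : Fin N → ℝ) (i : Fin N) :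
    reflectAdd N r a i = a i + r * a i.rev := rfl

/-- The coefficient vector of `X * Q + r * Q.reverse`. -/
def levinson {N : ℕ} (r : ℝ) (a : Fin N → ℝ) : Fin (N + 1) → ℝ :=
  Fin.snoc (reflectAdd N r a) r

theorem aeval_monicPoly_levinson {K : Type*} [Field K] [Algebra ℝ K] {N : ℕ} (r : ℝ)
    (a : Fin N → ℝ) {z : K} (hz : z ≠ 0) :
    Polynomial.aeval z (monicPoly (levinson r a)) =
      z * Polynomial.aeval z (monicPoly a) +
        algebraMap ℝ K r * (z ^ N * Polynomial.aeval z⁻¹ (monicPoly a)) := by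
  have h1 : ∀ i : Fin N, z ^ (N + 1 - ((i : ℕ) + 1)) = z * z ^ (N - ((i : ℕ) + 1)) := by
    intro i
    rw [← pow_succ']
    congr 1
    omega
  have h2 : ∑ i : Fin N, algebraMap ℝ K (a i.rev) * z ^ (N + 1 - ((i : ℕ) + 1)) =
      z ^ N * ∑ i : Fin N, algebraMap ℝ K (a i) * z⁻¹ ^ (N - ((i : ℕ) + 1)) := by
    rw [Finset.mul_sum, ← Equiv.sum_comp Fin.revPerm]
    refine Finset.sum_congr rfl fun i _ => ?_
    simp only [Fin.revPerm_apply, Fin.rev_rev, Fin.val_rev]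
    have hi : N + 1 - (N - ((i : ℕ) + 1) + 1) + (N - ((i : ℕ) + 1)) = N := by omega
    rw [mul_left_comm]
    congr 1
    rw [inv_pow, eq_mul_inv_iff_mul_eq₀ (pow_ne_zero _ hz), ← pow_add, hi]
  have h3 : z ^ N * z⁻¹ ^ N = 1 := by rw [← mul_pow, mul_inv_cancel₀ hz, one_pow]
  rw [aeval_monicPoly, aeval_monicPoly, aeval_monicPoly, Fin.sum_univ_castSucc]
  simp only [levinson, Fin.snoc_castSucc, Fin.snoc_last, reflectAdd_apply, Fin.val_castSucc,
    Fin.val_last, map_add, map_mul, add_mul, Finset.sum_add_distrib, mul_assoc,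
    ← Finset.mul_sum, h2, Nat.sub_self, pow_zero, mul_add, h3]
  simp only [h1, mul_left_comm _ z, ← Finset.mul_sum]
  ring

theorem levinson_mem_Omega {N : ℕ} {r : ℝ} (hr : |r| < 1) (a : Fin N → ℝ) :
    levinson r a ∈ Omega (N + 1) ↔ a ∈ Omega N := by
  have hrn : ‖(r : ℂ)‖ < 1 := by simpa using hr
  constructor
  · intro h z hz
    by_contra! hlt
    have hz0 : z ≠ 0 := by rintro rfl; simp at hlt; linarith
    have h1 := norm_pow_mul_aeval_inv_le h hlt.le
    have h2 := sub_one_pow_le_norm_aeval h hlt.le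
    have h3 : 0 < (‖z‖ - 1) ^ (N + 1) := pow_pos (by linarith) _
    have e1 := aeval_monicPoly_levinson r a hz0
    have e2 := aeval_monicPoly_levinson r a (inv_ne_zero hz0)
    rw [inv_inv, hz] at e2
    rw [hz] at e1
    -- With `Q(z) = 0`, eliminating `Q(z⁻¹)` gives `P(z) = r z^(N+1) P(z⁻¹)`, so `|P(z)| ≤ |r|
    -- |P(z)|`, although `P(z) ≠ 0`.
    have e3 : Polynomial.aeval z (monicPoly (levinson r a)) =
        r * (z ^ (N + 1) * Polynomial.aeval z⁻¹ (monicPoly (levinson r a))) := by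
      rw [e1, e2]
      simp only [Complex.coe_algebraMap]
      field_simp
      ring
    have e4 := congrArg norm e3
    rw [norm_mul] at e4
    nlinarith [norm_nonneg (r : ℂ)]
  · intro h z hz
    by_contra! hlt
    have hz0 : z ≠ 0 := by rintro rfl; simp at hlt; linarith
    have h1 := norm_pow_mul_aeval_inv_le h hlt.le
    have h2 := sub_one_pow_le_norm_aeval h hlt.le
    have h3 : 0 < (‖z‖ - 1) ^ N := pow_pos (by linarith) _
    rw [aeval_monicPoly_levinson r a hz0] at hz
    -- Rouché-style comparison: `|z Q(z)| > |Q(z)| > |r| |z^N Q(z⁻¹)|`, so the two terms cannot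
    -- cancel.
    have e4 := congrArg norm (eq_neg_of_add_eq_zero_left hz)
    rw [norm_neg, norm_mul, norm_mul, Complex.coe_algebraMap] at e4
    nlinarith [norm_nonneg (r : ℂ)]

theorem eval_one_levinson {N : ℕ} (r : ℝ) (a : Fin N → ℝ) :
    (monicPoly (levinson r a)).eval 1 = (1 + r) * (monicPoly a).eval 1 := by
  have := aeval_monicPoly_levinson (K := ℝ) r a one_ne_zero
  simp only [Polynomial.coe_aeval_eq_eval, Algebra.algebraMap_self, RingHom.id_apply, inv_one,
    one_pow, one_mul] at this
  rw [this]
  ring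

theorem eval_neg_one_levinson {N : ℕ} (r : ℝ) (a : Fin N → ℝ) :
    (monicPoly (levinson r a)).eval (-1) =
      (r * (-1) ^ N - 1) * (monicPoly a).eval (-1) := by
  have := aeval_monicPoly_levinson (K := ℝ) r a (neg_ne_zero.2 one_ne_zero)
  simp only [Polynomial.coe_aeval_eq_eval, Algebra.algebraMap_self, RingHom.id_apply,
    inv_neg, inv_one] at this
  rw [this]
  ring

/-- A positive factor leaves the argument of `y` unchanged, so no branch is crossed; `y = 0` is
covered by the convention for `0 ^ c`. -/
theorem ofReal_mul_cpow {x : ℝ} (hx : 0 < x) (y c : ℂ) :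
    ((x : ℂ) * y) ^ c = (x : ℂ) ^ c * y ^ c := by
  have hx' : (x : ℂ) ≠ 0 := by exact_mod_cast hx.ne'
  rcases eq_or_ne y 0 with rfl | hy
  · rcases eq_or_ne c 0 with rfl | hc
    · simp
    · simp [hc]
  · rw [Complex.cpow_def_of_ne_zero (mul_ne_zero hx' hy), Complex.cpow_def_of_ne_zero hx',
      Complex.cpow_def_of_ne_zero hy, Complex.log_ofReal_mul hx hy, add_mul, Complex.exp_add,
      Complex.ofReal_log hx.le]

theorem selbergIntegrand_levinson {N : ℕ} (α β : ℂ) {r : ℝ} (hr : |r| < 1) (a : Fin N → ℝ) :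
    selbergIntegrand (N + 1) α β (levinson r a) =
      ((1 + r : ℝ) : ℂ) ^ (α - 1) * ((1 - r * (-1) ^ N : ℝ) : ℂ) ^ (β - 1) *
        selbergIntegrand N α β a := by
  have h1 : 0 < 1 + r := by linarith [(abs_lt.1 hr).1]
  have h2 : 0 < 1 - r * (-1) ^ N := by
    have : |r * (-1) ^ N| < 1 := by simpa [abs_mul] using hr
    linarith [(abs_lt.1 this).2]
  rw [selbergIntegrand, selbergIntegrand, eval_one_levinson, eval_neg_one_levinson, abs_mul,
    abs_sub_comm, abs_of_pos h2, Complex.ofReal_mul, Complex.ofReal_mul, ofReal_mul_cpow h1,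
    ofReal_mul_cpow h2]
  ring

theorem measurable_selbergIntegrand (N : ℕ) (α β : ℂ) : Measurable (selbergIntegrand N α β) := by
  have h : ∀ z : ℝ, Measurable fun a : Fin N → ℝ => (monicPoly a).eval z := by
    intro z
    simp only [monicPoly, Polynomial.eval_add, Polynomial.eval_pow, Polynomial.eval_X,
      Polynomial.eval_finsetSum, Polynomial.eval_mul, Polynomial.eval_C]
    fun_prop
  have h1 := h 1
  have h2 := h (-1)
  unfold selbergIntegrand
  exact ((Complex.measurable_ofReal.comp h1).pow_const _).mul
    ((Complex.measurable_ofReal.comp (measurable_abs.comp h2)).pow_const _)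

/-! ### The Jacobian determinant. -/

theorem det_reflectAdd_even (k : ℕ) (r : ℝ) :
    LinearMap.det (reflectAdd (k + k) r) = (1 + r) ^ k * (1 - r) ^ k := by
  -- Reversing the second half pairs each index with its mirror image, so all four blocks become
  -- scalar.
  let e : Fin k ⊕ Fin k ≃ Fin (k + k) :=
    (Equiv.sumCongr (Equiv.refl _) Fin.revPerm).trans finSumFinEquiv
  have hl : ∀ i, e (Sum.inl i) = Fin.castAdd k i := fun i => rfl
  have hr : ∀ i, e (Sum.inr i) = Fin.natAdd k i.rev := fun i => rfl
  have hm : (LinearMap.toMatrix' (reflectAdd (k + k) r)).submatrix e e =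
      Matrix.fromBlocks 1 (r • 1) (r • 1) 1 := by
    ext i j
    rw [Matrix.submatrix_apply, LinearMap.toMatrix'_apply, reflectAdd_apply]
    rcases i with i | i <;> rcases j with j | j <;>
      simp only [hl, hr, Pi.single_apply, Matrix.fromBlocks_apply₁₁, Matrix.fromBlocks_apply₁₂,
        Matrix.fromBlocks_apply₂₁, Matrix.fromBlocks_apply₂₂, Matrix.smul_apply, Matrix.one_apply,
        Fin.ext_iff, Fin.val_rev, Fin.val_castAdd, Fin.val_natAdd] <;>
      have := i.2 <;> have := j.2 <;> split_ifs <;> first | omega | simp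
  rw [← LinearMap.det_toMatrix', ← Matrix.det_submatrix_equiv_self e, hm,
    Matrix.det_fromBlocks_one₂₂, smul_mul_smul_comm, Matrix.one_mul, ← mul_pow,
    show (1 : Matrix (Fin k) (Fin k) ℝ) - (r * r) • 1 = ((1 + r) * (1 - r)) • 1 by
      rw [show (1 + r) * (1 - r) = 1 - r * r by ring, sub_smul, one_smul],
    Matrix.det_smul, Matrix.det_one, mul_one, Fintype.card_fin]

theorem det_reflectAdd_odd (k : ℕ) (r : ℝ) :
    LinearMap.det (reflectAdd (k + 1 + k) r) = (1 + r) ^ (k + 1) * (1 - r) ^ k := by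
  -- The middle index is its own mirror image and contributes the extra factor `1 + r`.
  let e : (Fin k ⊕ Fin 1) ⊕ Fin k ≃ Fin (k + 1 + k) :=
    (Equiv.sumCongr finSumFinEquiv Fin.revPerm).trans finSumFinEquiv
  have hl : ∀ i, e (Sum.inl (Sum.inl i)) = Fin.castAdd k (Fin.castAdd 1 i) := fun i => rfl
  have hm : ∀ i, e (Sum.inl (Sum.inr i)) = Fin.castAdd k (Fin.natAdd k i) := fun i => rfl
  have hr : ∀ i, e (Sum.inr i) = Fin.natAdd (k + 1) i.rev := fun i => rfl
  have hM : (LinearMap.toMatrix' (reflectAdd (k + 1 + k) r)).submatrix e e =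
      Matrix.fromBlocks (Matrix.diagonal (Sum.elim 1 fun _ => 1 + r))
        (Matrix.fromRows (r • 1) 0) (Matrix.fromCols (r • 1) 0) 1 := by
    ext i j
    rw [Matrix.submatrix_apply, LinearMap.toMatrix'_apply, reflectAdd_apply]
    rcases i with (i | i) | i <;> rcases j with (j | j) | j <;>
      simp only [hl, hm, hr, Pi.single_apply, Matrix.fromBlocks_apply₁₁,
        Matrix.fromBlocks_apply₁₂, Matrix.fromBlocks_apply₂₁, Matrix.fromBlocks_apply₂₂,
        Matrix.fromRows_apply_inl, Matrix.fromRows_apply_inr, Matrix.fromCols_apply_inl,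
        Matrix.fromCols_apply_inr, Matrix.diagonal_apply, Sum.inl.injEq, Sum.inr.injEq,
        reduceCtorEq, if_false, Sum.elim_inl, Sum.elim_inr, Matrix.zero_apply,
        Matrix.smul_apply, Matrix.one_apply,
        Fin.ext_iff, Fin.val_rev, Fin.val_castAdd, Fin.val_natAdd] <;>
      have := i.2 <;> have := j.2 <;> split_ifs <;> first | omega | simp
  have hD : Matrix.diagonal (Sum.elim 1 fun _ => 1 + r) -
      Matrix.fromRows (r • (1 : Matrix (Fin k) (Fin k) ℝ)) 0 *
        Matrix.fromCols (r • (1 : Matrix (Fin k) (Fin k) ℝ)) (0 : Matrix (Fin k) (Fin 1) ℝ) =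
      Matrix.diagonal (Sum.elim (fun _ => (1 + r) * (1 - r)) fun _ => 1 + r) := by
    rw [Matrix.fromRows_mul_fromCols]
    ext i j
    rcases i with i | i <;> rcases j with j | j <;>
      simp [Matrix.diagonal_apply, Matrix.one_apply]
    split_ifs <;> ring
  rw [← LinearMap.det_toMatrix', ← Matrix.det_submatrix_equiv_self e, hM,
    Matrix.det_fromBlocks_one₂₂, hD, Matrix.det_diagonal, Fintype.prod_sum_type]
  simp only [Sum.elim_inl, Sum.elim_inr, Finset.prod_const, Finset.card_univ, Fintype.card_fin,
    pow_one, mul_pow]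
  ring

theorem det_reflectAdd (N : ℕ) (r : ℝ) :
    LinearMap.det (reflectAdd N r) = (1 + r) ^ ((N + 1) / 2) * (1 - r) ^ (N / 2) := by
  rcases Nat.even_or_odd' N with ⟨k, h | h⟩
  · obtain rfl : N = k + k := by omega
    rw [det_reflectAdd_even]
    congr 2 <;> omega
  · obtain rfl : N = k + 1 + k := by omega
    rw [det_reflectAdd_odd]
    congr 2 <;> omega

theorem det_reflectAdd_pos (N : ℕ) {r : ℝ} (hr : r ∈ Set.Ioo (-1 : ℝ) 1) :
    0 < LinearMap.det (reflectAdd N r) := by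
  rw [det_reflectAdd]
  exact mul_pos (pow_pos (by linarith [hr.1]) _) (pow_pos (by linarith [hr.2]) _)

/-! ### The change of variables. -/

/-- The measure on `(-1, 1)` whose density is the Jacobian of `levinson r`. -/
noncomputable def reflectionMeasure (N : ℕ) : Measure ℝ :=
  (volume.restrict (Set.Ioo (-1) 1)).withDensity
    fun r => ENNReal.ofReal (LinearMap.det (reflectAdd N r))

theorem measurable_ofReal_det_reflectAdd (N : ℕ) :
    Measurable fun r => ENNReal.ofReal (LinearMap.det (reflectAdd N r)) := by
  simp only [det_reflectAdd]
  fun_prop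

instance (N : ℕ) : SFinite (reflectionMeasure N) := by
  unfold reflectionMeasure
  infer_instance

theorem ae_reflectionMeasure (N : ℕ) : ∀ᵐ r ∂reflectionMeasure N, r ∈ Set.Ioo (-1 : ℝ) 1 :=
  (withDensity_absolutelyContinuous _ _).ae_le (ae_restrict_mem measurableSet_Ioo)

theorem measurable_levinson (N : ℕ) :
    Measurable fun p : ℝ × (Fin N → ℝ) => levinson p.1 p.2 := by
  refine measurable_pi_iff.2 fun i => ?_
  refine Fin.lastCases ?_ (fun i => ?_) i
  · simpa [levinson] using measurable_fst
  · simp only [levinson, Fin.snoc_castSucc, reflectAdd_apply]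
    fun_prop

/-- On the slice with last coordinate `r`, pulling back along `reflectAdd N r` divides volume by its
determinant, which the density of `reflectionMeasure` restores. -/
theorem map_levinson (N : ℕ) :
    ((reflectionMeasure N).prod volume).map (fun p : ℝ × (Fin N → ℝ) => levinson p.1 p.2) =
      volume.restrict {a : Fin (N + 1) → ℝ | a (Fin.last N) ∈ Set.Ioo (-1 : ℝ) 1} := by
  have hI : MeasurableSet {a : Fin (N + 1) → ℝ | a (Fin.last N) ∈ Set.Ioo (-1 : ℝ) 1} :=
    measurableSet_Ioo.preimage (measurable_pi_apply _)
  have he := (volume_preserving_piFinSuccAbove (fun _ : Fin (N + 1) => ℝ) (Fin.last N)).symm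
  have hes : ∀ r a, (MeasurableEquiv.piFinSuccAbove (fun _ : Fin (N + 1) => ℝ)
      (Fin.last N)).symm (r, a) = (Fin.snoc a r : Fin (N + 1) → ℝ) := fun r a => by
    rw [← Fin.insertNth_last']
    rfl
  ext s hs
  rw [Measure.map_apply (measurable_levinson N) hs,
    Measure.prod_apply (measurable_levinson N hs), reflectionMeasure,
    lintegral_withDensity_eq_lintegral_mul _ (measurable_ofReal_det_reflectAdd N)
      (measurable_measure_prodMk_left (measurable_levinson N hs)),
    Measure.restrict_apply hs, ← he.measure_preimage (hs.inter hI).nullMeasurableSet,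
    Measure.volume_eq_prod, Measure.prod_apply (MeasurableEquiv.measurable _ (hs.inter hI)),
    ← lintegral_indicator measurableSet_Ioo]
  refine lintegral_congr fun r => ?_
  by_cases hr : r ∈ Set.Ioo (-1 : ℝ) 1
  · have hd := det_reflectAdd_pos N hr
    rw [Set.indicator_of_mem hr, Pi.mul_apply]
    have h1 : Prod.mk r ⁻¹' ((fun p : ℝ × (Fin N → ℝ) => levinson p.1 p.2) ⁻¹' s) =
        reflectAdd N r ⁻¹' ((fun a : Fin N → ℝ => (Fin.snoc a r : Fin (N + 1) → ℝ)) ⁻¹' s) := rfl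
    rw [h1, Measure.addHaar_preimage_linearMap _ hd.ne', ← mul_assoc,
      ← ENNReal.ofReal_mul hd.le, abs_of_pos (inv_pos.2 hd), mul_inv_cancel₀ hd.ne',
      ENNReal.ofReal_one, one_mul]
    congr 1
    ext a
    have : (Fin.snoc a r : Fin (N + 1) → ℝ) (Fin.last N) = r := Fin.snoc_last _ _
    simp only [Set.mem_preimage, hes, Set.mem_inter_iff, Set.mem_ofPred_eq, this, hr, and_true]
  · rw [Set.indicator_of_notMem hr]
    symm
    refine (congrArg volume (Set.eq_empty_iff_forall_notMem.2 fun a => ?_)).trans measure_empty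
    have : (Fin.snoc a r : Fin (N + 1) → ℝ) (Fin.last N) = r := Fin.snoc_last _ _
    simp only [Set.mem_preimage, hes, Set.mem_inter_iff, Set.mem_ofPred_eq, this, hr, and_false,
      not_false_eq_true]

theorem restrict_Omega_succ (N : ℕ) :
    volume.restrict (Omega (N + 1)) =
      ((reflectionMeasure N).prod (volume.restrict (Omega N))).map
        fun p : ℝ × (Fin N → ℝ) => levinson p.1 p.2 := by
  have hI : MeasurableSet {a : Fin (N + 1) → ℝ | a (Fin.last N) ∈ Set.Ioo (-1 : ℝ) 1} :=
    measurableSet_Ioo.preimage (measurable_pi_apply _)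
  -- The boundary cases `r = ±1`, where the recursion degenerates, are null.
  have hnull : ∀ c : ℝ, ∀ᵐ a : Fin (N + 1) → ℝ, a (Fin.last N) ≠ c := fun c => by
    rw [volume_pi]
    exact Measure.ae_eval_ne (μ := fun _ : Fin (N + 1) => (volume : Measure ℝ)) _ _
  have h1 : volume.restrict (Omega (N + 1)) =
      (volume.restrict {a : Fin (N + 1) → ℝ | a (Fin.last N) ∈ Set.Ioo (-1 : ℝ) 1}).restrict
        (Omega (N + 1)) := by
    rw [Measure.restrict_restrict (isClosed_Omega _).measurableSet]
    apply Measure.restrict_congr_set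
    filter_upwards [hnull 1, hnull (-1)] with a ha1 ha2
    apply propext
    refine ⟨fun h => ⟨h, ?_⟩, fun h => h.1⟩
    have h3 := abs_le.1 (abs_last_le_one h)
    exact ⟨lt_of_le_of_ne h3.1 ha2.symm, lt_of_le_of_ne h3.2 ha1⟩
  rw [h1, ← map_levinson, Measure.restrict_map (measurable_levinson N)
    (isClosed_Omega _).measurableSet, ← Measure.restrict_univ (μ := reflectionMeasure N),
    Measure.prod_restrict, Measure.restrict_univ]
  congr 1
  apply Measure.restrict_congr_set
  have h2 : ∀ᵐ p ∂((reflectionMeasure N).prod (volume : Measure (Fin N → ℝ))),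
      p.1 ∈ Set.Ioo (-1 : ℝ) 1 :=
    Measure.quasiMeasurePreserving_fst.ae (ae_reflectionMeasure N)
  filter_upwards [h2] with p hp
  apply propext
  have := levinson_mem_Omega (abs_lt.2 hp) p.2
  exact this.trans ⟨fun h => ⟨trivial, h⟩, fun h => h.2⟩

/-! ### The beta integral on `(-1, 1)`. -/

theorem integral_one_add_cpow_mul_one_sub_cpow (u v : ℂ) :
    ∫ r in Set.Ioo (-1 : ℝ) 1, ((1 + r : ℝ) : ℂ) ^ (u - 1) * ((1 - r : ℝ) : ℂ) ^ (v - 1) =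
      2 ^ (u + v - 1) * Complex.betaIntegral u v := by
  rw [← integral_Ioc_eq_integral_Ioo, ← intervalIntegral.integral_of_le (by norm_num)]
  have h := Complex.betaIntegral_scaled u v (a := 2) two_pos
  have h2 := intervalIntegral.integral_comp_add_right (a := -1) (b := 1)
    (fun x : ℝ => (x : ℂ) ^ (u - 1) * (((2 : ℝ) : ℂ) - x) ^ (v - 1)) 1
  norm_num at h2 h
  rw [← h, ← h2]
  refine intervalIntegral.integral_congr fun x _ => ?_
  simp only [Complex.ofReal_add, Complex.ofReal_sub, Complex.ofReal_one]
  congr 2 <;> ring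

theorem betaIntegral_eq {u v : ℂ} (hu : 0 < u.re) (hv : 0 < v.re) :
    Complex.betaIntegral u v = Complex.Gamma u * Complex.Gamma v / Complex.Gamma (u + v) := by
  rw [Complex.Gamma_mul_Gamma_eq_betaIntegral hu hv, mul_div_cancel_left₀]
  exact Complex.Gamma_ne_zero_of_re_pos (by simpa using add_pos hu hv)

theorem integrableOn_one_add_cpow_mul_one_sub_cpow {u v : ℂ} (hu : 0 < u.re) (hv : 0 < v.re) :
    IntegrableOn (fun r : ℝ => ((1 + r : ℝ) : ℂ) ^ (u - 1) * ((1 - r : ℝ) : ℂ) ^ (v - 1))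
      (Set.Ioo (-1 : ℝ) 1) := by
  by_contra h
  have h1 := integral_one_add_cpow_mul_one_sub_cpow u v
  -- A non-integrable function has integral `0` by default, but the Gamma quotient is nonzero.
  rw [integral_undef h, betaIntegral_eq hu hv] at h1
  refine mul_ne_zero ?_ (div_ne_zero (mul_ne_zero ?_ ?_) ?_) h1.symm
  · simp [Complex.cpow_eq_zero_iff]
  · exact Complex.Gamma_ne_zero_of_re_pos hu
  · exact Complex.Gamma_ne_zero_of_re_pos hv
  · exact Complex.Gamma_ne_zero_of_re_pos (by simpa using add_pos hu hv)

theorem integrable_and_integral_reflectionMeasure {N : ℕ} {w : ℝ → ℂ} {u v : ℂ} (hu : 0 < u.re)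
    (hv : 0 < v.re)
    (hw : ∀ r ∈ Set.Ioo (-1 : ℝ) 1, ((LinearMap.det (reflectAdd N r) : ℝ) : ℂ) * w r =
      ((1 + r : ℝ) : ℂ) ^ (u - 1) * ((1 - r : ℝ) : ℂ) ^ (v - 1)) :
    Integrable w (reflectionMeasure N) ∧ ∫ r, w r ∂reflectionMeasure N =
      2 ^ (u + v - 1) * (Complex.Gamma u * Complex.Gamma v / Complex.Gamma (u + v)) := by
  have hlt : ∀ᵐ r ∂volume.restrict (Set.Ioo (-1 : ℝ) 1),
      ENNReal.ofReal (LinearMap.det (reflectAdd N r)) < ⊤ := by simp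
  have hm := measurable_ofReal_det_reflectAdd N
  have hae : ∀ r ∈ Set.Ioo (-1 : ℝ) 1,
      (ENNReal.ofReal (LinearMap.det (reflectAdd N r))).toReal • w r =
      ((1 + r : ℝ) : ℂ) ^ (u - 1) * ((1 - r : ℝ) : ℂ) ^ (v - 1) := fun r hr => by
    rw [ENNReal.toReal_ofReal (det_reflectAdd_pos N hr).le, Complex.real_smul, hw r hr]
  constructor
  · rw [reflectionMeasure, integrable_withDensity_iff_integrable_smul' hm hlt]
    exact (integrableOn_congr_fun hae measurableSet_Ioo).2
      (integrableOn_one_add_cpow_mul_one_sub_cpow hu hv)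
  · rw [reflectionMeasure, integral_withDensity_eq_integral_toReal_smul hm hlt,
      setIntegral_congr_fun measurableSet_Ioo hae, integral_one_add_cpow_mul_one_sub_cpow,
      betaIntegral_eq hu hv]

/-! ### The induction on the degree. -/

/-- The exponents `u`, `v` collect the Jacobian and both powers of the integrand, so that one
argument serves both parities. -/
theorem selberg_succ {N : ℕ} {α β u v : ℂ} (hu : 0 < u.re) (hv : 0 < v.re)
    (hw : ∀ r ∈ Set.Ioo (-1 : ℝ) 1, ((LinearMap.det (reflectAdd N r) : ℝ) : ℂ) *
      (((1 + r : ℝ) : ℂ) ^ (α - 1) * ((1 - r * (-1) ^ N : ℝ) : ℂ) ^ (β - 1)) =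
      ((1 + r : ℝ) : ℂ) ^ (u - 1) * ((1 - r : ℝ) : ℂ) ^ (v - 1))
    (hN : IntegrableOn (selbergIntegrand N α β) (Omega N)) :
    IntegrableOn (selbergIntegrand (N + 1) α β) (Omega (N + 1)) ∧
      selbergIntegral (N + 1) α β =
        2 ^ (u + v - 1) * (Complex.Gamma u * Complex.Gamma v / Complex.Gamma (u + v)) *
          selbergIntegral N α β := by
  obtain ⟨hi, he⟩ := integrable_and_integral_reflectionMeasure hu hv hw
  have hae : (fun p : ℝ × (Fin N → ℝ) => selbergIntegrand (N + 1) α β (levinson p.1 p.2))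
      =ᵐ[(reflectionMeasure N).prod (volume.restrict (Omega N))] fun p =>
      (((1 + p.1 : ℝ) : ℂ) ^ (α - 1) * ((1 - p.1 * (-1) ^ N : ℝ) : ℂ) ^ (β - 1)) *
        selbergIntegrand N α β p.2 := by
    have h2 : ∀ᵐ p ∂((reflectionMeasure N).prod (volume.restrict (Omega N))),
        p.1 ∈ Set.Ioo (-1 : ℝ) 1 :=
      Measure.quasiMeasurePreserving_fst.ae (ae_reflectionMeasure N)
    filter_upwards [h2] with p hp
    exact selbergIntegrand_levinson α β (abs_lt.2 hp) p.2
  have hm := (measurable_levinson N).aemeasurable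
    (μ := (reflectionMeasure N).prod (volume.restrict (Omega N)))
  have hs := measurable_selbergIntegrand (N + 1) α β
  constructor
  · rw [IntegrableOn, restrict_Omega_succ, integrable_map_measure hs.aestronglyMeasurable hm]
    exact (integrable_congr hae).2 (hi.mul_prod hN)
  · rw [selbergIntegral, restrict_Omega_succ, integral_map hm hs.aestronglyMeasurable,
      integral_congr_ae hae]
    rw [← he]
    exact integral_prod_mul
      (fun r : ℝ => ((1 + r : ℝ) : ℂ) ^ (α - 1) * ((1 - r * (-1) ^ N : ℝ) : ℂ) ^ (β - 1))
      (selbergIntegrand N α β)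

theorem natPow_mul_cpow {x : ℂ} (hx : x ≠ 0) (n : ℕ) (c : ℂ) : x ^ n * x ^ c = x ^ (c + n) := by
  rw [Complex.cpow_add _ _ hx, Complex.cpow_natCast, mul_comm]

theorem selberg_succ_even {k : ℕ} {α β : ℂ} (hα : 0 < α.re) (hβ : 0 < β.re)
    (hN : IntegrableOn (selbergIntegrand (2 * k) α β) (Omega (2 * k))) :
    IntegrableOn (selbergIntegrand (2 * k + 1) α β) (Omega (2 * k + 1)) ∧
      selbergIntegral (2 * k + 1) α β =
        2 ^ (α + β + 2 * k - 1) * (Complex.Gamma (α + k) * Complex.Gamma (β + k) /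
          Complex.Gamma (α + β + 2 * k)) * selbergIntegral (2 * k) α β := by
  have h := selberg_succ (N := 2 * k) (α := α) (β := β) (u := α + k) (v := β + k)
    (by simp; positivity) (by simp; positivity) ?_ hN
  · rwa [show α + k + (β + k) = α + β + 2 * k by ring] at h
  · intro r hr
    have h1 : ((1 + r : ℝ) : ℂ) ≠ 0 := by exact_mod_cast (by linarith [hr.1] : 0 < 1 + r).ne'
    have h2 : ((1 - r : ℝ) : ℂ) ≠ 0 := by exact_mod_cast (by linarith [hr.2] : 0 < 1 - r).ne'
    rw [det_reflectAdd, pow_mul, neg_one_sq, one_pow, mul_one, show (2 * k + 1) / 2 = k by omega,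
      show 2 * k / 2 = k by omega, Complex.ofReal_mul, Complex.ofReal_pow, Complex.ofReal_pow,
      mul_mul_mul_comm, natPow_mul_cpow h1, natPow_mul_cpow h2]
    congr 2 <;> ring

theorem selberg_succ_odd {k : ℕ} {α β : ℂ} (hα : 0 < α.re) (hβ : 0 < β.re)
    (hN : IntegrableOn (selbergIntegrand (2 * k + 1) α β) (Omega (2 * k + 1))) :
    IntegrableOn (selbergIntegrand (2 * k + 2) α β) (Omega (2 * k + 2)) ∧
      selbergIntegral (2 * k + 2) α β =
        2 ^ (α + β + 2 * (k + 1 : ℕ) - 2) * (Complex.Gamma (α + β + (k + 1 : ℕ) - 1) *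
          Complex.Gamma (k + 1 : ℕ) / Complex.Gamma (α + β + 2 * (k + 1 : ℕ) - 1)) *
            selbergIntegral (2 * k + 1) α β := by
  -- For odd degree `P(-1)` also contributes `1 + r`: its exponent is `(k + 1) + (α - 1) + (β - 1)`,
  -- and `1 - r` keeps only the Jacobian's `k`.
  have h := selberg_succ (N := 2 * k + 1) (α := α) (β := β) (u := α + β + (k + 1 : ℕ) - 1)
    (v := (k + 1 : ℕ)) (by simp; linarith [(Nat.cast_nonneg k : (0 : ℝ) ≤ k)])
    (by simp; positivity) ?_ hN
  · rwa [show α + β + (k + 1 : ℕ) - 1 + (k + 1 : ℕ) = α + β + 2 * (k + 1 : ℕ) - 1 by ring,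
      show α + β + 2 * (k + 1 : ℕ) - 1 - 1 = α + β + 2 * (k + 1 : ℕ) - 2 by ring] at h
  · intro r hr
    have h1 : ((1 + r : ℝ) : ℂ) ≠ 0 := by exact_mod_cast (by linarith [hr.1] : 0 < 1 + r).ne'
    have h2 : ((1 - r : ℝ) : ℂ) ≠ 0 := by exact_mod_cast (by linarith [hr.2] : 0 < 1 - r).ne'
    rw [det_reflectAdd, pow_succ, pow_mul, neg_one_sq, one_pow, one_mul, mul_neg_one, sub_neg_eq_add,
      show (2 * k + 1 + 1) / 2 = k + 1 by omega, show (2 * k + 1) / 2 = k by omega,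
      Complex.ofReal_mul, Complex.ofReal_pow, Complex.ofReal_pow, ← Complex.cpow_add _ _ h1,
      mul_right_comm, natPow_mul_cpow h1, ← Complex.cpow_natCast _ k]
    congr 2 <;> push_cast <;> ring

theorem selberg_zero (α β : ℂ) :
    IntegrableOn (selbergIntegrand 0 α β) (Omega 0) ∧ selbergIntegral 0 α β = 1 := by
  have h1 : Omega 0 = Set.univ := by
    ext a
    simp [Omega, aeval_monicPoly]
  have h2 : selbergIntegrand 0 α β = fun _ => 1 := by
    ext a
    simp [selbergIntegrand, monicPoly]
  have : IsFiniteMeasure (volume : Measure (Fin 0 → ℝ)) := by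
    rw [volume_pi, Measure.pi_of_empty]
    infer_instance
  rw [selbergIntegral, h1, h2, integrableOn_univ, setIntegral_univ]
  refine ⟨integrable_const _, ?_⟩
  rw [volume_pi, Measure.pi_of_empty]
  simp

theorem mainTheorem5 (N : ℕ) (α β : ℂ) (hα : 0 < α.re) (hβ : 0 < β.re) :
    IntegrableOn (selbergIntegrand N α β) (Omega N) (volume : Measure (Fin N → ℝ)) ∧
    selbergIntegral N α β =
      (∏ k ∈ Finset.Icc 1 (N / 2),
        (2 : ℂ) ^ (α + β + 2 * (k : ℂ) - 2) *
          (Complex.Gamma (α + β + (k : ℂ) - 1) * Complex.Gamma (k : ℂ) /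
            Complex.Gamma (α + β + 2 * (k : ℂ) - 1))) *
      (∏ k ∈ Finset.range ((N + 1) / 2),
        (2 : ℂ) ^ (α + β + 2 * (k : ℂ) - 1) *
          (Complex.Gamma (α + (k : ℂ)) * Complex.Gamma (β + (k : ℂ)) /
            Complex.Gamma (α + β + 2 * (k : ℂ)))) ∧
    selbergIntegral N α β =
      (∏ k ∈ Finset.Icc 1 N,
        (2 : ℂ) ^ (α + β + (k : ℂ) - 2) / Complex.Gamma (α + β + (k : ℂ) - 1)) *
      (∏ k ∈ Finset.Icc 1 (N / 2),
        Complex.Gamma (α + β + (k : ℂ) - 1) * Complex.Gamma (k : ℂ)) *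
      (∏ k ∈ Finset.Icc 1 ((N + 1) / 2),
        Complex.Gamma (α + (k : ℂ) - 1) * Complex.Gamma (β + (k : ℂ) - 1)) := by
  induction N with
  | zero => simpa using selberg_zero α β
  | succ N ih =>
    obtain ⟨ih1, ih2, ih3⟩ := ih
    rcases Nat.even_or_odd' N with ⟨k, rfl | rfl⟩
    · obtain ⟨h1, h2⟩ := selberg_succ_even hα hβ ih1
      rw [show (2 * k) / 2 = k by omega, show (2 * k + 1) / 2 = k by omega] at ih2 ih3
      rw [show (2 * k + 1) / 2 = k by omega, show (2 * k + 1 + 1) / 2 = k + 1 by omega]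
      refine ⟨h1, ?_, ?_⟩
      · rw [h2, ih2, Finset.prod_range_succ]
        ring
      -- Only the first and third products gain a factor here; from odd to even degree it is the
      -- first and second.
      · rw [h2, ih3, Finset.prod_Icc_succ_top (by omega), Finset.prod_Icc_succ_top (by omega)]
        push_cast
        rw [show α + β + (2 * k + 1) - 2 = α + β + 2 * k - 1 by ring,
          show α + β + (2 * k + 1) - 1 = α + β + 2 * k by ring,
          show α + ((k : ℂ) + 1) - 1 = α + k by ring, show β + ((k : ℂ) + 1) - 1 = β + k by ring]
        ring
    · obtain ⟨h1, h2⟩ := selberg_succ_odd hα hβ ih1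
      rw [show (2 * k + 1) / 2 = k by omega, show (2 * k + 1 + 1) / 2 = k + 1 by omega] at ih2 ih3
      rw [show (2 * k + 1 + 1) / 2 = k + 1 by omega,
        show (2 * k + 1 + 1 + 1) / 2 = k + 1 by omega]
      refine ⟨h1, ?_, ?_⟩
      · rw [h2, ih2, Finset.prod_Icc_succ_top (b := k) (by omega)]
        ring
      · rw [h2, ih3, Finset.prod_Icc_succ_top (b := 2 * k + 1) (by omega),
          Finset.prod_Icc_succ_top (b := k) (by omega), Finset.prod_Icc_succ_top (b := k) (by omega)]
        rw [show ((2 * k + 1 + 1 : ℕ) : ℂ) = 2 * (k + 1 : ℕ) by push_cast; ring]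
        ring
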